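/- **Setting.** Let $R$ be a Noetherian local ring with infinite residue field $k$, and let $N$ be a finitely generated $R$-module. For a prime $P$ of $R$ let $\mu_P(M)$ denote the minimal number of generators of the $R_P$-module $M_P$, and $rf_P(M)$ the maximal rank of a free direct summand of $M_P$; put $\mu(M)=\mu_{\mathfrak m}(M)$, where $\mathfrak m$ is the maximal ideal. Write $(-)^*=\operatorname{Hom}_R(-,R)$. For $x\in N$ the order ideal is $N^*(x)=\{f(x)\mid f\in N^*\}$; the unit ideal has height $\infty$. If $x_1,\dots,x_n$ is a minimal generating set of $N$ and $\pi:R^n\to N$ sends $e_i$ to $x_i$, put $N^\perp=\operatorname{Coker}(\pi^*)$ (up to isomorphism this depends only on $N$). The Rees algebra of a finitely generated $R$-module $M$ is $\mathcal R(M)=\operatorname{Sym}(M)/\bigcap_g\ker(\operatorname{Sym}(g))$, where $g$ ranges over all $R$-linear maps from $M$ to free $R$-modules, and the analytic spread of $M$ is $\ell(M)=\dim(k\otimes_R\mathcal R(M))$. The module $M$ satisfies $G_s$ (for a positive integer $s$) if there is $e$ such that $M_Q$ is free of rank $e$ for every minimal prime $Q$ of $R$ and $\mu_Q(M)\le\dim(R_Q)+e-1$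 for every prime $Q$ with $1\le\dim(R_Q)\le s-1$; it satisfies $G_\infty$ if it satisfies $G_s$ for every $s\geq 1$. **Proposition.** Let $r\ge 0$ be an integer, and consider the condition $(\ast)$ $\; rf_P(N)\ge r+1-\dim(R_P)$ for every prime $P$ of $R$ such that $N_P$ is not free. 1. If $(\ast)$ holds and $\operatorname{ht}(N^*(x))\le r$ for every $x\in N$, then $\ell(N^\perp)=\mu(N)$. 2. If $N_Q$ is free of rank $r$ for every minimal prime $Q$ of $R$ and $N^\perp$ satisfies $G_\infty$, then $(\ast)$ holds. 3. Consequently, if $N_Q$ is free of rank $r$ for every minimal prime $Q$ of $R$, $N^\perp$ satisfies $G_\infty$, and $\operatorname{ht}(N^*(x))\le r$ for every $x\in N$, then $\ell(N^\perp)=\mu(N)$. -/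

import Mathlib

open scoped TensorProduct

universe u v w

noncomputable section

namespace OrderIdeals

/-- `μ(M)`, the minimal number of generators of a finitely generated module. -/
def minGens (A : Type u) (M : Type v) [CommRing A] [AddCommGroup M] [Module A M] : ℕ :=
  (⊤ : Submodule A M).spanFinrank

/-- The maximal rank of a free direct summand of a finitely generated module `M`. A free
direct summand of rank `k` is given by a split injection `A ^ k → M`. -/
def freeSummandRank (A : Type u) (M : Type v) [CommRing A] [AddCommGroup M] [Module A M] : ℕ :=
  sSup {k : ℕ | ∃ (i : (Fin k → A) →ₗ[A] M) (p : M →ₗ[A] (Fin k → A)), p ∘ₗ i = LinearMap.id}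

section

variable (R : Type u) (M : Type v) [CommRing R] [AddCommGroup M] [Module R M]

/-- `μ_P(M)`, the minimal number of generators of `M_P` over `R_P`. -/
def minGensAt (P : PrimeSpectrum R) : ℕ :=
  minGens (Localization.AtPrime P.asIdeal) (LocalizedModule P.asIdeal.primeCompl M)

/-- `rf_P(M)`, the maximal rank of an `R_P`-free direct summand of `M_P`. -/
def rf (P : PrimeSpectrum R) : ℕ :=
  freeSummandRank (Localization.AtPrime P.asIdeal) (LocalizedModule P.asIdeal.primeCompl M)

/-- `dim(R_P)`. -/
def localDim (P : PrimeSpectrum R) : WithBot ℕ∞ :=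
  ringKrullDim (Localization.AtPrime P.asIdeal)

/-- `M_Q` is free of rank `r` for every minimal prime `Q` of `R`. -/
def HasGenericRank (r : ℕ) : Prop :=
  ∀ Q : PrimeSpectrum R, Q.asIdeal ∈ minimalPrimes R →
    Module.Free (Localization.AtPrime Q.asIdeal) (LocalizedModule Q.asIdeal.primeCompl M) ∧
    Module.finrank (Localization.AtPrime Q.asIdeal)
      (LocalizedModule Q.asIdeal.primeCompl M) = r

/-- The condition `G_s`: `M` is free of constant rank `e` at the minimal primes, and
`μ_Q(M) ≤ dim(R_Q) + e - 1` for every prime `Q` with `1 ≤ dim(R_Q) ≤ s - 1`. -/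
def SatisfiesG (s : ℕ) : Prop :=
  ∃ e : ℕ, HasGenericRank R M e ∧
    ∀ Q : PrimeSpectrum R, 1 ≤ localDim R Q → localDim R Q + 1 ≤ (s : WithBot ℕ∞) →
      (minGensAt R M Q : WithBot ℕ∞) + 1 ≤ localDim R Q + (e : WithBot ℕ∞)

/-- The condition `G_∞`: `G_s` holds for every positive integer `s`. -/
def SatisfiesGInfty : Prop :=
  ∀ s : ℕ, 0 < s → SatisfiesG R M s

variable {M}

/-- The order ideal `N^*(x) = {f(x) | f ∈ N^*}`. -/
def orderIdeal (x : M) : Ideal R :=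
  LinearMap.range (Module.Dual.eval R M x)

/-- `[x_1, …, x_n]^⊥ = Coker(π^*)`, where `π : R ^ n → N` sends `e_i` to `x_i`. If `R` is local
and the `x_i` are minimal generators of `N`, this is the perpendicular module `N^⊥`. -/
abbrev Perp {n : ℕ} (x : Fin n → M) : Type u :=
  Module.Dual R (Fin n → R) ⧸ LinearMap.range (Fintype.linearCombination R x).dualMap

variable {R}

/-- `Sym(g) : Sym(M) → Sym(G)`. -/
def symMap {G : Type w} [AddCommGroup G] [Module R G] (g : M →ₗ[R] G) :
    SymmetricAlgebra R M →ₐ[R] SymmetricAlgebra R G :=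
  SymmetricAlgebra.lift (SymmetricAlgebra.ι R G ∘ₗ g)

variable (R M)

/-- The intersection of the kernels of `Sym(g)` over all maps `g` from `M` to free modules. -/
def reesIdeal : Ideal (SymmetricAlgebra R M) :=
  ⨅ (G : Type u) (_ : AddCommGroup G) (_ : Module R G) (_ : Module.Free R G)
    (g : M →ₗ[R] G), RingHom.ker (symMap g)

/-- The Rees algebra of a module. -/
abbrev ReesAlgebra : Type (max u v) :=
  SymmetricAlgebra R M ⧸ reesIdeal R M

/-- The analytic spread `ℓ(M)`: the Krull dimension of `k ⊗ Rees(M)`, `k` the residue field. -/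
def analyticSpread [IsLocalRing R] : WithBot ℕ∞ :=
  ringKrullDim (IsLocalRing.ResidueField R ⊗[R] ReesAlgebra R M)

/-- `rf_P(M) ≥ r + 1 - dim(R_P)` for every prime `P` in the nonfree locus of `M`. -/
def LargeFreeSummands (r : ℕ) : Prop :=
  ∀ P : PrimeSpectrum R, P ∉ Module.freeLocus R M →
    (r : WithBot ℕ∞) + 1 ≤ (rf R M P : WithBot ℕ∞) + localDim R P

end

end OrderIdeals

end

/-! Let `x₁, …, xₙ` generate `N`. The linear forms `∑ f(xᵢ) Xᵢ`, for `f` in `N^*`, generate the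
order ideal of the generic element `∑ Xᵢ xᵢ`. Their coefficient vectors span a space of dimension
`rf_P(N)` over the residue field `κ(P)`, and `N^⊥` has these vectors as relations, whence
`μ_P(N^⊥) + rf_P(N) = n`; the second part of the proposition follows from this equality.

Condition `(∗)` says that on the nonfree locus of `N` the generic order ideal has height at least
`r + 1`. If the special fiber of the Rees algebra of `N^⊥` had dimension less than `n`, some
equation `F` of the Rees algebra would be nonzero modulo the maximal ideal. As the residue field
is infinite, the variables can be specialized to `a ∈ R ^ n` with `F(a)` a unit and without
loss of height. At a prime `P` where `N` is free and that contains the order ideal of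
`y = ∑ aᵢ xᵢ`, the vector `a` is congruent to a relation among the `xᵢ` over `R_P`, that is, to a
linear map `N^⊥ → R_P`, which forces `F(a) ∈ P`. So `N` is not free at any prime containing the
order ideal of `y`, which therefore has height at least `r + 1`.
-/

namespace OrderIdeals

section Height

variable {A : Type*} [CommRing A]

theorem le_height_iff_forall_isPrime {I : Ideal A} {s : ℕ∞} :
    s ≤ I.height ↔ ∀ P : Ideal A, P.IsPrime → I ≤ P → s ≤ P.height := by
  refine ⟨fun h P _ hIP ↦ h.trans (Ideal.height_mono hIP), fun h ↦ ?_⟩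
  rw [Ideal.height_eq_inf_minimalPrimes]
  exact le_iInf₂ fun P hP ↦ h P hP.isPrime hP.1.2

open Polynomial in
theorem height_comap_evalRingHom_le [IsNoetherianRing A] (a : A) (P : Ideal A) [P.IsPrime] :
    (P.comap (evalRingHom a)).height ≤ P.height + 1 := by
  let e := (quotientSpanXSubCAlgEquiv a).toRingEquiv
  have hcomap : P.comap (evalRingHom a) = (P.comap e).comap (Ideal.Quotient.mk _) := rfl
  have hmem : X - C a ∈ P.comap (evalRingHom a) := by simp
  refine (Ideal.height_le_height_add_one_of_mem hmem).trans_eq ?_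
  rw [hcomap, Ideal.map_comap_of_surjective _ Ideal.Quotient.mk_surjective, RingEquiv.height_comap]

open Polynomial in
theorem le_height_map_evalRingHom [IsNoetherianRing A] {I : Ideal A[X]} {s : ℕ∞}
    (hs : s ≤ I.height) (a : A) (ha : ∀ Q ∈ I.minimalPrimes, X - C a ∉ Q) :
    s ≤ (I.map (evalRingHom a)).height := by
  refine le_height_iff_forall_isPrime.2 fun P _ hIP ↦ ?_
  obtain ⟨Q, hQ, hQP⟩ := Ideal.exists_minimalPrimes_le (Ideal.map_le_iff_le_comap.1 hIP)
  have := hQ.isPrime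
  have hlt : Q < P.comap (evalRingHom a) :=
    lt_of_le_of_ne hQP fun h ↦ ha Q hQ (h ▸ by simp)
  have hheight : Q.height + 1 ≤ P.height + 1 :=
    (Ideal.height_add_one_le_of_lt_of_isPrime hlt).trans (height_comap_evalRingHom_le a P)
  exact (le_height_iff_forall_isPrime.1 hs Q this hQ.1.2).trans
    ((ENat.add_le_add_iff_right ENat.one_ne_top).1 hheight)

end Height

section Specialization

open IsLocalRing

variable {R : Type*} [CommRing R] [IsLocalRing R]

open Polynomial in
theorem residue_eq_of_X_sub_C_mem {B : Type*} [CommRing B] [Algebra R B] {Q : Ideal B[X]}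
    (hQ : Q ≠ ⊤) {a b : R} (ha : X - C (algebraMap R B a) ∈ Q)
    (hb : X - C (algebraMap R B b) ∈ Q) : residue R a = residue R b := by
  by_contra hne
  have hunit : IsUnit (b - a) := by
    rw [← residue_ne_zero_iff_isUnit, map_sub]
    exact sub_ne_zero.2 (Ne.symm hne)
  have hmem : C (algebraMap R B (b - a)) ∈ Q := by
    convert Q.sub_mem ha hb using 1
    simp
  exact hQ (Q.eq_top_of_isUnit_mem hmem ((hunit.map (algebraMap R B)).map C))

open Polynomial in
theorem exists_residue_notMem_and_le_height [Infinite (ResidueField R)] {B : Type*} [CommRing B]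
    [IsNoetherianRing B] [Algebra R B] {I : Ideal B[X]} {s : ℕ∞} (hs : s ≤ I.height)
    {T : Set (ResidueField R)} (hT : T.Finite) :
    ∃ a : R, residue R a ∉ T ∧ s ≤ (I.map (evalRingHom (algebraMap R B a))).height := by
  let bad (Q : Ideal B[X]) : Set (ResidueField R) :=
    residue R '' {a | X - C (algebraMap R B a) ∈ Q}
  have hbad : (⋃ Q ∈ I.minimalPrimes, bad Q).Finite := by
    refine (Ideal.finite_minimalPrimes_of_isNoetherianRing _ I).biUnion fun Q hQ ↦ ?_
    refine Set.Subsingleton.finite ?_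
    rintro _ ⟨a, ha, rfl⟩ _ ⟨b, hb, rfl⟩
    exact residue_eq_of_X_sub_C_mem hQ.isPrime.ne_top ha hb
  obtain ⟨c, hc⟩ := (hT.union hbad).infinite_compl.nonempty
  obtain ⟨a, rfl⟩ := residue_surjective c
  rw [Set.mem_compl_iff, Set.mem_union, not_or] at hc
  exact ⟨a, hc.1, le_height_map_evalRingHom hs _ fun Q hQ ha ↦
    hc.2 (Set.mem_biUnion hQ ⟨a, ha, rfl⟩)⟩

open MvPolynomial in
theorem eval_comp_evalRingHom_comp_finSuccEquiv {A : Type*} [CommRing A] {n : ℕ} (y : A)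
    (s : Fin n → A) :
    (eval s).comp ((Polynomial.evalRingHom (C y)).comp
      (finSuccEquiv A n : MvPolynomial (Fin (n + 1)) A →+* _)) = eval (Fin.cons y s) := by
  refine ringHom_ext (fun r ↦ ?_) fun i ↦ ?_
  · simp [finSuccEquiv_apply]
  · refine Fin.cases ?_ (fun j ↦ ?_) i <;> simp [finSuccEquiv_apply]

open MvPolynomial in
theorem exists_eval_ne_zero_and_le_height [IsNoetherianRing R] [Infinite (ResidueField R)]
    {s : ℕ∞} {n : ℕ} {I : Ideal (MvPolynomial (Fin n) R)} (hI : s ≤ I.height)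
    {F : MvPolynomial (Fin n) (ResidueField R)} (hF : F ≠ 0) :
    ∃ a : Fin n → R, eval (residue R ∘ a) F ≠ 0 ∧ s ≤ (I.map (eval a)).height := by
  induction n with
  | zero =>
    refine ⟨0, ?_, ?_⟩
    · obtain ⟨c, rfl⟩ := C_surjective (Fin 0) F
      simpa using hF
    · have heval : eval (0 : Fin 0 → R) = (isEmptyRingEquiv R (Fin 0) : _ →+* R) :=
        ringHom_ext (fun r ↦ (eval_C r).trans (coeff_zero_C r).symm) fun i ↦ i.elim0
      rw [heval]
      exact hI.trans_eq (RingEquiv.height_map (isEmptyRingEquiv R (Fin 0)) I).symm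
  | succ n ih =>
    let J := I.map (finSuccEquiv R n : _ →+* Polynomial (MvPolynomial (Fin n) R))
    have hJ : s ≤ J.height :=
      hI.trans_eq (RingEquiv.height_map (finSuccEquiv R n).toRingEquiv I).symm
    let G := finSuccEquiv (ResidueField R) n F
    have hG : G ≠ 0 := by simpa [G] using hF
    have hroots : {c : ResidueField R | G.IsRoot (C c)}.Finite :=
      (Polynomial.finite_setOfPred_isRoot hG).preimage (C_injective _ _).injOn
    obtain ⟨y, hy, hJy⟩ := exists_residue_notMem_and_le_height hJ hroots
    obtain ⟨a, ha, hJa⟩ := ih hJy (F := G.eval (C (residue R y))) hy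
    refine ⟨Fin.cons y a, ?_, ?_⟩
    · rw [Fin.comp_cons, ← eval_comp_evalRingHom_comp_finSuccEquiv]
      exact ha
    · rw [← eval_comp_evalRingHom_comp_finSuccEquiv, ← Ideal.map_map, ← Ideal.map_map]
      exact hJa

end Specialization

section LinearForms

open MvPolynomial

variable {R : Type*} [CommRing R] {σ : Type*}

/-- The linear form `∑ cᵢ Xᵢ`. -/
noncomputable def linearForm [Fintype σ] (c : σ → R) : MvPolynomial σ R :=
  ∑ i, C (c i) * X i

theorem eval_linearForm [Fintype σ] (a c : σ → R) : eval a (linearForm c) = ∑ i, c i * a i := by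
  simp [linearForm]

section

variable [DecidableEq σ] (P : Ideal R) [P.IsPrime]

/-- The homomorphism from `R[X]` to the symmetric algebra over `κ(P)` of `κ(P)^σ / W`, which is a
polynomial ring over `κ(P)`: it kills `P` and the linear forms with coefficient vector in `W`. -/
noncomputable def toLinearFiber (W : Submodule P.ResidueField (σ → P.ResidueField)) :
    MvPolynomial σ R →+* SymmetricAlgebra P.ResidueField ((σ → P.ResidueField) ⧸ W) :=
  eval₂Hom ((algebraMap P.ResidueField _).comp (algebraMap R P.ResidueField))
    fun i ↦ SymmetricAlgebra.ι _ _ (W.mkQ (Pi.single i 1))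

/-- The prime ideal of `R[X]` generated, over the generic point of `R / P`, by `P` and the linear
forms with coefficient vector in `W`. -/
noncomputable def linearPrime (W : Submodule P.ResidueField (σ → P.ResidueField)) :
    Ideal (MvPolynomial σ R) :=
  RingHom.ker (toLinearFiber P W)

instance linearPrime_isPrime (W : Submodule P.ResidueField (σ → P.ResidueField)) :
    (linearPrime P W).IsPrime :=
  RingHom.ker_isPrime _

theorem comap_C_linearPrime (W : Submodule P.ResidueField (σ → P.ResidueField)) :
    (linearPrime P W).comap C = P := by
  ext r
  simp [linearPrime, toLinearFiber, RingHom.mem_ker]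

theorem toLinearFiber_linearForm [Fintype σ]
    (W : Submodule P.ResidueField (σ → P.ResidueField)) (c : σ → R) :
    toLinearFiber P W (linearForm c) =
      SymmetricAlgebra.ι _ _ (W.mkQ (algebraMap R P.ResidueField ∘ c)) := by
  rw [pi_eq_sum_univ' (algebraMap R P.ResidueField ∘ c)]
  simp only [linearForm, toLinearFiber, map_sum, map_mul, coe_eval₂Hom, eval₂_C, eval₂_X, map_smul]
  exact Finset.sum_congr rfl fun i _ ↦ (Algebra.smul_def _ _).symm

theorem symmetricAlgebra_ι_injective (K V : Type*) [Field K] [AddCommGroup V] [Module K V] :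
    Function.Injective (SymmetricAlgebra.ι K V) := by
  refine (injective_iff_map_eq_zero _).2 fun v hv ↦
    (Module.forall_dual_apply_eq_zero_iff K v).1 fun φ ↦ ?_
  rw [← SymmetricAlgebra.lift_ι_apply φ v, hv, map_zero]

theorem linearForm_mem_linearPrime_iff [Fintype σ]
    (W : Submodule P.ResidueField (σ → P.ResidueField)) (c : σ → R) :
    linearForm c ∈ linearPrime P W ↔ algebraMap R P.ResidueField ∘ c ∈ W := by
  rw [linearPrime, RingHom.mem_ker, toLinearFiber_linearForm,
    map_eq_zero_iff _ (symmetricAlgebra_ι_injective _ _), Submodule.mkQ_apply,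
    Submodule.Quotient.mk_eq_zero]

theorem linearPrime_span_le [Fintype σ] {Q : Ideal (MvPolynomial σ R)} [Q.IsPrime]
    (hQ : Q.comap C = P) {ι : Type*} {c : ι → σ → R} (hc : ∀ j, linearForm (c j) ∈ Q) :
    linearPrime P (Submodule.span P.ResidueField
      (Set.range fun j ↦ algebraMap R P.ResidueField ∘ c j)) ≤ Q := by
  let φ : P.ResidueField →+* Q.ResidueField := Ideal.ResidueField.map P Q C hQ.symm
  have hφ (r : R) : φ (algebraMap R P.ResidueField r) =
      algebraMap (MvPolynomial σ R) Q.ResidueField (C r) := Ideal.ResidueField.map_algebraMap ..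
  let _ := φ.toAlgebra
  let l : (σ → P.ResidueField) →ₗ[P.ResidueField] Q.ResidueField :=
    Fintype.linearCombination P.ResidueField
      fun i ↦ algebraMap (MvPolynomial σ R) Q.ResidueField (X i)
  have hl : Submodule.span P.ResidueField
      (Set.range fun j ↦ algebraMap R P.ResidueField ∘ c j) ≤ LinearMap.ker l := by
    rw [Submodule.span_le]
    rintro _ ⟨j, rfl⟩
    have hzero := (Ideal.algebraMap_residueField_eq_zero (I := Q)).2 (hc j)
    rw [linearForm, map_sum] at hzero
    rw [SetLike.mem_coe, LinearMap.mem_ker, Fintype.linearCombination_apply, ← hzero]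
    refine Finset.sum_congr rfl fun i _ ↦ ?_
    rw [map_mul, ← hφ]
    rfl
  let ψ := SymmetricAlgebra.lift (Submodule.liftQ _ l hl)
  have hψ : ψ.toRingHom.comp (toLinearFiber P _) =
      algebraMap (MvPolynomial σ R) Q.ResidueField := by
    refine ringHom_ext (fun r ↦ ?_) fun i ↦ ?_
    · rw [← hφ]
      simp only [toLinearFiber, RingHom.comp_apply, coe_eval₂Hom, eval₂_C]
      exact ψ.commutes _
    · simp [toLinearFiber, ψ, l, Fintype.linearCombination_apply, Pi.single_apply]
  intro f hf
  rw [← Ideal.algebraMap_residueField_eq_zero (I := Q), ← hψ, RingHom.comp_apply,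
    RingHom.mem_ker.1 hf, map_zero]

end

variable [Fintype σ] {P : Ideal R} [P.IsPrime] {Q : Ideal (MvPolynomial σ R)} [Q.IsPrime]

theorem height_add_le_height_of_linearIndependent [IsNoetherianRing R] (hQ : Q.comap C = P)
    {k : ℕ} {c : Fin k → σ → R} (hcQ : ∀ j, linearForm (c j) ∈ Q)
    (hc : LinearIndependent P.ResidueField fun j ↦ algebraMap R P.ResidueField ∘ c j) :
    P.height + k ≤ Q.height := by
  classical
  induction k generalizing Q with
  | zero =>
    have : Q.LiesOver P := ⟨hQ.symm⟩
    rw [Ideal.height_eq_height_add_of_liesOver_of_hasGoingDown P Q]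
    simp
  | succ k ih =>
    rw [linearIndependent_finSucc'] at hc
    let W := Submodule.span P.ResidueField
      (Set.range fun j : Fin k ↦ algebraMap R P.ResidueField ∘ c j.castSucc)
    have hind : P.height + k ≤ (linearPrime P W).height :=
      ih (comap_C_linearPrime P W)
        (fun j ↦ (linearForm_mem_linearPrime_iff P W _).2 (Submodule.subset_span ⟨j, rfl⟩)) hc.1
    have hlt : linearPrime P W < Q := by
      refine lt_of_le_of_ne (linearPrime_span_le P hQ fun j ↦ hcQ j.castSucc) fun h ↦ hc.2 ?_
      exact (linearForm_mem_linearPrime_iff P W _).1 (h ▸ hcQ (Fin.last k))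
    calc P.height + (k + 1 : ℕ) = P.height + k + 1 := by push_cast; rw [add_assoc]
      _ ≤ (linearPrime P W).height + 1 := by gcongr
      _ ≤ Q.height := Ideal.height_add_one_le_of_lt_of_isPrime hlt

theorem height_add_finrank_span_le_height [IsNoetherianRing R] (hQ : Q.comap C = P)
    {ι : Type*} {c : ι → σ → R} (hcQ : ∀ j, linearForm (c j) ∈ Q) :
    P.height + Module.finrank P.ResidueField (Submodule.span P.ResidueField
      (Set.range fun j ↦ algebraMap R P.ResidueField ∘ c j)) ≤ Q.height := by
  obtain ⟨b, hbmem, -, hb⟩ := Submodule.exists_fun_fin_finrank_span_eq P.ResidueField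
    (Set.range fun j ↦ algebraMap R P.ResidueField ∘ c j)
  choose j hj using hbmem
  obtain rfl := funext hj
  exact height_add_le_height_of_linearIndependent hQ (fun i ↦ hcQ (j i)) hb

end LinearForms

/-- For generators `xᵢ` of `N`, the functionals on `N` are recorded by the vectors `(f(xᵢ))ᵢ`;
this is the `K`-span of their images in `K^ι`. -/
def dualSpan (R K : Type*) {N ι : Type*} [CommRing R] [AddCommGroup N] [Module R N] [CommRing K]
    [Algebra R K] (x : ι → N) : Submodule K (ι → K) :=
  Submodule.span K (Set.range fun f : Module.Dual R N ↦ algebraMap R K ∘ f ∘ x)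

section FreeSummand

open IsLocalRing

variable {A : Type*} [CommRing A] [IsLocalRing A]

theorem exists_mul_eq_one_of_linearIndependent_residue {m n : Type*} [Finite m] [DecidableEq m]
    [Fintype n] {B : Matrix m n A}
    (hB : LinearIndependent (ResidueField A) (B.map (residue A)).row) :
    ∃ C : Matrix n m A, B * C = 1 := by
  have := Fintype.ofFinite m
  have hsurj : Function.Surjective (B.map (residue A)).mulVec := by
    refine LinearMap.range_eq_top (f := (B.map (residue A)).mulVecLin).1 ?_
    refine Submodule.eq_top_of_finrank_eq (hB.rank_matrix.trans ?_)
    exact (Module.finrank_fintype_fun_eq_card _).symm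
  obtain ⟨D, hD⟩ := Matrix.mulVec_surjective_iff_exists_right_inverse.1 hsurj
  obtain ⟨C, rfl⟩ : ∃ C : Matrix n m A, C.map (residue A) = D :=
    ⟨D.map (Function.surjInv residue_surjective), by ext; simp [Function.surjInv_eq]⟩
  have hdet : IsUnit (B * C).det := by
    rw [← isUnit_map_iff (residue A), RingHom.map_det, RingHom.mapMatrix_apply, Matrix.map_mul, hD,
      Matrix.det_one]
    exact isUnit_one
  exact ⟨C * (B * C)⁻¹, by rw [← Matrix.mul_assoc, Matrix.mul_nonsing_inv _ hdet]⟩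

variable {M ι : Type*} [AddCommGroup M] [Module A M] {y : ι → M}

theorem linearIndependent_of_split (hy : Submodule.span A (Set.range y) = ⊤) {κ : Type*}
    [Finite κ] {i : (κ → A) →ₗ[A] M} {p : M →ₗ[A] (κ → A)} (hpi : p ∘ₗ i = LinearMap.id) :
    LinearIndependent (ResidueField A) fun j ↦ residue A ∘ (LinearMap.proj j ∘ₗ p) ∘ y := by
  classical
  have := Fintype.ofFinite κ
  refine Fintype.linearIndependent_iff.2 fun t ht l ↦ ?_
  let θ : M →ₗ[A] ResidueField A :=
    ∑ j, t j • (Algebra.linearMap A (ResidueField A) ∘ₗ LinearMap.proj j ∘ₗ p)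
  have hθ : θ = 0 := by
    refine LinearMap.ext_on_range hy fun a ↦ ?_
    simpa [θ] using congr($ht a)
  have hl : p (i (Pi.single l 1)) = Pi.single l 1 := congr($hpi (Pi.single l 1))
  simpa [θ, hl, Pi.single_apply, apply_ite] using congr($hθ (i (Pi.single l 1)))

theorem exists_split_of_linearIndependent [Finite ι] {κ : Type*} [Finite κ]
    {f : κ → Module.Dual A M}
    (hf : LinearIndependent (ResidueField A) fun j ↦ residue A ∘ f j ∘ y) :
    ∃ (i : (κ → A) →ₗ[A] M) (p : M →ₗ[A] (κ → A)), p ∘ₗ i = LinearMap.id := by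
  classical
  have := Fintype.ofFinite κ
  have := Fintype.ofFinite ι
  obtain ⟨C, hC⟩ := exists_mul_eq_one_of_linearIndependent_residue
    (B := Matrix.of fun j a ↦ f j (y a)) hf
  refine ⟨Fintype.linearCombination A fun l ↦ ∑ a, C a l • y a, LinearMap.pi f,
    LinearMap.pi_ext' fun l ↦ LinearMap.ext_ring <| funext fun j ↦ ?_⟩
  simpa [Matrix.mul_apply, Matrix.one_apply, Pi.single_apply, mul_comm] using congr($hC j l)

theorem exists_split_iff_le_finrank_dualSpan [Finite ι]
    (hy : Submodule.span A (Set.range y) = ⊤) (k : ℕ) :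
    (∃ (i : (Fin k → A) →ₗ[A] M) (p : M →ₗ[A] (Fin k → A)), p ∘ₗ i = LinearMap.id) ↔
      k ≤ Module.finrank (ResidueField A) (dualSpan A (ResidueField A) y) := by
  have := Fintype.ofFinite ι
  constructor
  · rintro ⟨i, p, hpi⟩
    have hind := linearIndependent_of_split hy hpi
    rw [← Fintype.card_fin k, ← finrank_span_eq_card hind]
    exact Submodule.finrank_mono (Submodule.span_mono (Set.range_subset_iff.2 fun j ↦ ⟨_, rfl⟩))
  · intro hk
    obtain ⟨b, hbmem, -, hb⟩ := Submodule.exists_fun_fin_finrank_span_eq (ResidueField A)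
      (Set.range fun f : Module.Dual A M ↦ algebraMap A (ResidueField A) ∘ f ∘ y)
    choose f hf using hbmem
    obtain rfl := funext hf
    exact exists_split_of_linearIndependent (hb.comp _ (Fin.castLE_injective hk))

theorem freeSummandRank_eq_finrank_dualSpan {A : Type u} {M : Type v} [CommRing A] [IsLocalRing A]
    [AddCommGroup M] [Module A M] {ι : Type*} [Finite ι] {y : ι → M}
    (hy : Submodule.span A (Set.range y) = ⊤) :
    freeSummandRank A M = Module.finrank (ResidueField A) (dualSpan A (ResidueField A) y) := by
  simp_rw [freeSummandRank, exists_split_iff_le_finrank_dualSpan hy]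
  exact csSup_Iic

theorem freeSummandRank_of_free {A : Type u} {M : Type v} [CommRing A] [Nontrivial A]
    [AddCommGroup M] [Module A M] [Module.Free A M] [Module.Finite A M] :
    freeSummandRank A M = Module.finrank A M := by
  refine IsGreatest.csSup_eq ⟨?_, ?_⟩
  · let e := (Module.finBasis A M).equivFun
    exact ⟨e.symm, e, by ext; simp⟩
  · rintro k ⟨i, p, hpi⟩
    have hinj : Function.Injective i := LinearMap.injective_of_comp_eq_id i p hpi
    simpa using LinearMap.finrank_le_finrank_of_injective hinj

end FreeSummand

section Localization

variable {R : Type u} {N : Type v} [CommRing R] [AddCommGroup N] [Module R N]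

theorem localDim_eq_height (P : PrimeSpectrum R) : localDim R P = P.asIdeal.height :=
  IsLocalization.AtPrime.ringKrullDim_eq_height P.asIdeal _

section

variable (P : Ideal R) [P.IsPrime]

theorem span_range_mkLinearMap_eq_top {ι : Type*} {x : ι → N}
    (hx : Submodule.span R (Set.range x) = ⊤) :
    Submodule.span (Localization.AtPrime P)
      (Set.range (LocalizedModule.mkLinearMap P.primeCompl N ∘ x)) = ⊤ := by
  rw [Set.range_comp]
  exact span_eq_top_of_isLocalizedModule _ P.primeCompl _ hx

theorem exists_dual_eq_smul_localized [Module.FinitePresentation R N]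
    (g : Module.Dual (Localization.AtPrime P) (LocalizedModule P.primeCompl N)) :
    ∃ (f : Module.Dual R N) (s : P.primeCompl), ∀ y,
      algebraMap R (Localization.AtPrime P) (f y) =
        s • g (LocalizedModule.mkLinearMap P.primeCompl N y) := by
  obtain ⟨f, s, h⟩ := Module.FinitePresentation.exists_lift_of_isLocalizedModule P.primeCompl
    (Algebra.linearMap R (Localization.AtPrime P))
    (g.restrictScalars R ∘ₗ LocalizedModule.mkLinearMap P.primeCompl N)
  exact ⟨f, s, fun y ↦ congr($h y)⟩

theorem exists_dual_localized_eq (f : Module.Dual R N) :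
    ∃ g : Module.Dual (Localization.AtPrime P) (LocalizedModule P.primeCompl N), ∀ y,
      g (LocalizedModule.mkLinearMap P.primeCompl N y) =
        algebraMap R (Localization.AtPrime P) (f y) :=
  ⟨IsLocalizedModule.mapExtendScalars P.primeCompl (LocalizedModule.mkLinearMap P.primeCompl N)
      (Algebra.linearMap R (Localization.AtPrime P)) (Localization.AtPrime P) f,
    IsLocalizedModule.map_apply P.primeCompl _ (Algebra.linearMap R _) f⟩

theorem dualSpan_localizedModule [Module.FinitePresentation R N] {ι : Type*} (x : ι → N) :
    dualSpan (Localization.AtPrime P) P.ResidueField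
      (LocalizedModule.mkLinearMap P.primeCompl N ∘ x) = dualSpan R P.ResidueField x := by
  refine le_antisymm (Submodule.span_le.2 ?_) (Submodule.span_le.2 ?_)
  · rintro _ ⟨g, rfl⟩
    obtain ⟨f, s, hf⟩ := exists_dual_eq_smul_localized P g
    have hs : algebraMap R P.ResidueField s ≠ 0 :=
      fun h ↦ s.2 (Ideal.algebraMap_residueField_eq_zero.1 h)
    refine (Submodule.smul_mem_iff _ hs).1 (Submodule.subset_span ⟨f, funext fun i ↦ ?_⟩)
    simp only [Function.comp_apply, Pi.smul_apply, smul_eq_mul]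
    rw [IsScalarTower.algebraMap_apply R (Localization.AtPrime P) P.ResidueField, hf,
      Submonoid.smul_def, Algebra.smul_def, map_mul, ← IsScalarTower.algebraMap_apply]
  · rintro _ ⟨f, rfl⟩
    obtain ⟨g, hg⟩ := exists_dual_localized_eq P f
    refine Submodule.subset_span ⟨g, funext fun i ↦ ?_⟩
    simp only [Function.comp_apply]
    rw [hg, ← IsScalarTower.algebraMap_apply]

end

theorem rf_eq_finrank_dualSpan [Module.FinitePresentation R N] {ι : Type*} [Finite ι] {x : ι → N}
    (hx : Submodule.span R (Set.range x) = ⊤) (P : PrimeSpectrum R) :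
    rf R N P =
      Module.finrank P.asIdeal.ResidueField (dualSpan R P.asIdeal.ResidueField x) := by
  rw [← dualSpan_localizedModule]
  exact freeSummandRank_eq_finrank_dualSpan (span_range_mkLinearMap_eq_top P.asIdeal hx)

theorem minGensAt_eq_finrank_tensorProduct [Module.Finite R N] (P : PrimeSpectrum R) :
    minGensAt R N P =
      Module.finrank P.asIdeal.ResidueField (P.asIdeal.ResidueField ⊗[R] N) := by
  let A := Localization.AtPrime P.asIdeal
  let K := P.asIdeal.ResidueField
  let e : K ⊗[A] (⊤ : Submodule A (LocalizedModule P.asIdeal.primeCompl N)) ≃ₗ[K] K ⊗[R] N :=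
    ((Submodule.topEquiv.trans (LocalizedModule.equivTensorProduct _ N)).baseChange A K _ _).trans
      (TensorProduct.AlgebraTensorModule.cancelBaseChange R A K K N)
  rw [← e.finrank_eq, Module.finrank_eq_spanFinrank_of_free]
  exact (TensorProduct.spanFinrank_top_eq_of_residueField _ Module.Finite.fg_top).symm

end Localization

section Perp

variable {R : Type u} {N : Type v} [CommRing R] [AddCommGroup N] [Module R N] {n : ℕ}
  (x : Fin n → N)

/-- The class in `N^⊥` of the `i`-th coordinate function on `R ^ n`; these classes generate
`N^⊥`. -/
noncomputable def perpGen (i : Fin n) : Perp R x :=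
  Submodule.mkQ _ ((Pi.basisFun R (Fin n)).dualBasis i)

theorem span_range_perpGen : Submodule.span R (Set.range (perpGen (R := R) x)) = ⊤ := by
  have hcomp : perpGen (R := R) x = Submodule.mkQ _ ∘ (Pi.basisFun R (Fin n)).dualBasis := rfl
  rw [hcomp, Set.range_comp, ← Submodule.map_span, Module.Basis.span_eq, Submodule.map_top,
    Submodule.range_mkQ]

theorem sum_smul_perpGen (f : Module.Dual R N) : ∑ i, f (x i) • perpGen (R := R) x i = 0 := by
  have hsum : ∑ i, f (x i) • (Pi.basisFun R (Fin n)).dualBasis i =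
      (Fintype.linearCombination R x).dualMap f := by
    simpa using (Pi.basisFun R (Fin n)).sum_dual_apply_smul_coord
      ((Fintype.linearCombination R x).dualMap f)
  simp only [perpGen, ← map_smul, ← map_sum, hsum]
  exact (Submodule.Quotient.mk_eq_zero _).2 ⟨f, rfl⟩

/-- The map out of `N^⊥` sending its generators to elements `wᵢ` that satisfy the defining
relations of `N^⊥`, one for each functional on `N`. -/
noncomputable def perpLift {V : Type*} [AddCommGroup V] [Module R V] (w : Fin n → V)
    (hw : ∀ f : Module.Dual R N, ∑ i, f (x i) • w i = 0) : Perp R x →ₗ[R] V :=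
  Submodule.liftQ _ ((Pi.basisFun R (Fin n)).dualBasis.constr R w) <| by
    rintro _ ⟨f, rfl⟩
    simpa [Module.Basis.constr_apply_fintype] using hw f

@[simp]
theorem perpLift_perpGen {V : Type*} [AddCommGroup V] [Module R V] (w : Fin n → V)
    (hw : ∀ f : Module.Dual R N, ∑ i, f (x i) • w i = 0) (i : Fin n) :
    perpLift x w hw (perpGen x i) = w i :=
  (Pi.basisFun R (Fin n)).dualBasis.constr_basis R w i

section

variable (K : Type*) [CommRing K] [Algebra R K]

theorem sum_smul_mkQ_dualSpan_single (f : Module.Dual R N) :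
    ∑ i, f (x i) • (dualSpan R K x).mkQ (Pi.single i 1) = 0 := by
  have hsum : ∑ i, f (x i) • (Pi.single i 1 : Fin n → K) = algebraMap R K ∘ f ∘ x := by
    ext j
    simp [Finset.sum_apply, Pi.single_apply, Algebra.smul_def]
  have hmem : algebraMap R K ∘ f ∘ x ∈ dualSpan R K x := Submodule.subset_span ⟨f, rfl⟩
  rw [← hsum, ← Submodule.Quotient.mk_eq_zero, ← Submodule.mkQ_apply, map_sum] at hmem
  exact hmem

theorem dualSpan_le_ker_linearCombination_perpGen :
    dualSpan R K x ≤
      LinearMap.ker (Fintype.linearCombination K fun i ↦ (1 : K) ⊗ₜ[R] perpGen (R := R) x i) := by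
  rw [dualSpan, Submodule.span_le]
  rintro _ ⟨f, rfl⟩
  have hzero := congr((1 : K) ⊗ₜ[R] $(sum_smul_perpGen x f))
  rw [TensorProduct.tmul_zero, TensorProduct.tmul_sum] at hzero
  simpa [Fintype.linearCombination_apply, Algebra.smul_def] using hzero

/-- Base change of the presentation of `N^⊥` by the coordinate functions. -/
noncomputable def perpBaseChangeEquiv : K ⊗[R] Perp R x ≃ₗ[K] (Fin n → K) ⧸ dualSpan R K x :=
  LinearEquiv.ofLinearMap
    (LinearMap.liftBaseChange K (perpLift x _ (sum_smul_mkQ_dualSpan_single x K)))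
    (Submodule.liftQ _ _ (dualSpan_le_ker_linearCombination_perpGen x K))
    (by ext i; simp)
    (by
      refine TensorProduct.AlgebraTensorModule.curry_injective (LinearMap.ext_ring ?_)
      refine LinearMap.ext_on_range (span_range_perpGen x) fun i ↦ ?_
      simp)

end

theorem minGensAt_perp_add_rf [Module.FinitePresentation R N]
    (hx : Submodule.span R (Set.range x) = ⊤) (P : PrimeSpectrum R) :
    minGensAt R (Perp R x) P + rf R N P = n := by
  rw [minGensAt_eq_finrank_tensorProduct, (perpBaseChangeEquiv x _).finrank_eq,
    rf_eq_finrank_dualSpan hx, Submodule.finrank_quotient_add_finrank, Module.finrank_fin_fun]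

theorem add_eq_of_hasGenericRank [Nontrivial R] [Module.FinitePresentation R N]
    {x : Fin n → N} (hx : Submodule.span R (Set.range x) = ⊤) {r e : ℕ}
    (hN : HasGenericRank R N r) (hperp : HasGenericRank R (Perp R x) e) : e + r = n := by
  obtain ⟨Q, hQ⟩ := Ideal.nonempty_minimalPrimes (bot_ne_top (α := Ideal R))
  let q : PrimeSpectrum R := ⟨Q, hQ.isPrime⟩
  have := (hN q hQ).1
  have := (hperp q hQ).1
  have hrf : rf R N q = r := freeSummandRank_of_free.trans (hN q hQ).2
  have hμ : minGensAt R (Perp R x) q = e :=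
    Module.finrank_eq_spanFinrank_of_free.symm.trans (hperp q hQ).2
  rw [← minGensAt_perp_add_rf x hx q, hrf, hμ]

theorem largeFreeSummands_of_satisfiesGInfty [IsNoetherianRing R] [Module.Finite R N]
    {x : Fin n → N} (hx : Submodule.span R (Set.range x) = ⊤) {r : ℕ}
    (hN : HasGenericRank R N r) (hG : SatisfiesGInfty R (Perp R x)) :
    LargeFreeSummands R N r := by
  have := Module.finitePresentation_of_finite R N
  intro P hP
  have := P.nontrivial
  obtain ⟨h, hh⟩ := ENat.ne_top_iff_exists.1 (P.asIdeal.height_ne_top P.isPrime.ne_top)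
  have hdim : localDim R P = h := by rw [localDim_eq_height, ← hh]; rfl
  have hpos : 1 ≤ h := by
    refine Nat.one_le_iff_ne_zero.2 fun h0 ↦ hP (hN P ?_).1
    rw [← Ideal.height_eq_zero_iff, ← hh, h0, Nat.cast_zero]
  obtain ⟨e, he, hμ⟩ := hG (h + 1) h.succ_pos
  have hgen := minGensAt_perp_add_rf x hx P
  have hrank := add_eq_of_hasGenericRank hx hN he
  have hle := hμ P (by rw [hdim]; exact_mod_cast hpos) (by rw [hdim]; exact_mod_cast le_rfl)
  rw [hdim] at hle ⊢
  norm_cast at hle ⊢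
  omega

end Perp

section Fiber

open IsLocalRing in
theorem ringKrullDim_residueField_tensorProduct {R B : Type*} [CommRing R] [IsLocalRing R]
    [CommRing B] [Algebra R B] {n : ℕ} {π : MvPolynomial (Fin n) R →ₐ[R] B}
    (hπ : Function.Surjective π)
    (hker : ∀ F, π F = 0 → MvPolynomial.map (residue R) F = 0) :
    ringKrullDim (ResidueField R ⊗[R] B) = n := by
  let k := ResidueField R
  have hdim : ringKrullDim (MvPolynomial (Fin n) k) = n := by
    simp [MvPolynomial.ringKrullDim_of_isNoetherianRing]
  rw [← hdim]
  refine le_antisymm ?_ ?_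
  · let fiber : k ⊗[R] MvPolynomial (Fin n) R →ₐ[k] k ⊗[R] B :=
      Algebra.TensorProduct.map (AlgHom.id k k) π
    have hfiber : Function.Surjective fiber :=
      TensorProduct.map_surjective (g := .id) (g' := π.toLinearMap) Function.surjective_id hπ
    rw [← ringKrullDim_eq_of_ringEquiv (MvPolynomial.algebraTensorAlgEquiv R k).toRingEquiv]
    exact ringKrullDim_le_of_surjective fiber.toRingHom hfiber
  · let descend : B →ₐ[R] MvPolynomial (Fin n) k :=
      AlgHom.liftOfSurjective π hπ (MvPolynomial.mapAlgHom (Algebra.ofId R k)) hker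
    let unfiber : k ⊗[R] B →ₐ[R] MvPolynomial (Fin n) k :=
      Algebra.TensorProduct.productMap (IsScalarTower.toAlgHom R k _) descend
    have hunfiber : Function.Surjective unfiber := by
      intro G
      obtain ⟨F, rfl⟩ := MvPolynomial.map_surjective _ residue_surjective G
      refine ⟨1 ⊗ₜ π F, ?_⟩
      rw [Algebra.TensorProduct.productMap_apply_tmul, map_one, one_mul]
      exact AlgHom.liftOfSurjective_apply ..
    exact ringKrullDim_le_of_surjective unfiber.toRingHom hunfiber

end Fiber

section Rees

variable {R : Type u} {M : Type v} [CommRing R] [AddCommGroup M] [Module R M]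

theorem lift_eq_zero_of_mem_reesIdeal [Module.FinitePresentation R M] (S : Submonoid R)
    {A : Type*} [CommRing A] [Algebra R A] [IsLocalization S A] {y : SymmetricAlgebra R M}
    (hy : y ∈ reesIdeal R M) (g : M →ₗ[R] A) : SymmetricAlgebra.lift g y = 0 := by
  obtain ⟨h, s, hs⟩ :=
    Module.FinitePresentation.exists_lift_of_isLocalizedModule S (Algebra.linearMap R A) g
  let divide : SymmetricAlgebra R R →ₐ[R] A :=
    SymmetricAlgebra.lift (LinearMap.toSpanSingleton R A (IsLocalization.mk' A 1 s))
  have hι (m : M) : divide (symMap h (SymmetricAlgebra.ι R M m)) = g m := by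
    have hm : algebraMap R A (h m) = algebraMap R A s * g m :=
      congr($hs m).trans (Algebra.smul_def _ _)
    simp only [divide, symMap, LinearMap.comp_apply, SymmetricAlgebra.lift_ι_apply,
      LinearMap.toSpanSingleton_apply, Algebra.smul_def, hm]
    rw [mul_right_comm, IsLocalization.mk'_spec', map_one, one_mul]
  have hfactor : divide.comp (symMap h) = SymmetricAlgebra.lift g := by
    ext m
    exact (hι m).trans (SymmetricAlgebra.lift_ι_apply ..).symm
  have hsym : symMap h y = 0 := by
    simp only [reesIdeal, Ideal.mem_iInf] at hy
    exact hy R _ _ inferInstance h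
  rw [← hfactor, AlgHom.comp_apply, hsym, map_zero]

section Presentation

variable {σ : Type*} (x : σ → M)

/-- The presentation of the Rees algebra of `M` by a polynomial ring with one variable for each
of the elements `x i` of `M`; it is surjective when these generate `M`. -/
noncomputable def reesPresentation : MvPolynomial σ R →ₐ[R] ReesAlgebra R M :=
  MvPolynomial.aeval fun i ↦ Ideal.Quotient.mk (reesIdeal R M) (SymmetricAlgebra.ι R M (x i))

variable {x}

theorem reesPresentation_surjective (hx : Submodule.span R (Set.range x) = ⊤) :
    Function.Surjective (reesPresentation (R := R) x) := by
  intro z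
  obtain ⟨y, rfl⟩ := Ideal.Quotient.mk_surjective z
  rw [← AlgHom.mem_range]
  induction y using SymmetricAlgebra.induction with
  | algebraMap c => exact Subalgebra.algebraMap_mem _ c
  | ι m =>
    have hspan : Submodule.span R (Set.range x) ≤
        (Subalgebra.toSubmodule (reesPresentation (R := R) x).range).comap
          ((Ideal.Quotient.mkₐ R (reesIdeal R M)).toLinearMap ∘ₗ SymmetricAlgebra.ι R M) := by
      rw [Submodule.span_le]
      rintro _ ⟨i, rfl⟩
      exact ⟨MvPolynomial.X i, by simp [reesPresentation]⟩
    exact hspan (hx ▸ Submodule.mem_top)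
  | mul a b ha hb =>
    exact map_mul (Ideal.Quotient.mk (reesIdeal R M)) a b ▸ Subalgebra.mul_mem _ ha hb
  | add a b ha hb =>
    exact map_add (Ideal.Quotient.mk (reesIdeal R M)) a b ▸ Subalgebra.add_mem _ ha hb

theorem aeval_eq_zero_of_reesPresentation_eq_zero [Module.FinitePresentation R M]
    (S : Submonoid R) {A : Type*} [CommRing A] [Algebra R A] [IsLocalization S A]
    {F : MvPolynomial σ R} (hF : reesPresentation x F = 0) (g : M →ₗ[R] A) :
    MvPolynomial.aeval (g ∘ x) F = 0 := by
  let liftRees : ReesAlgebra R M →ₐ[R] A :=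
    Ideal.Quotient.liftₐ (reesIdeal R M) (SymmetricAlgebra.lift g)
      fun y hy ↦ lift_eq_zero_of_mem_reesIdeal S hy g
  have hcomp : liftRees.comp (reesPresentation x) = MvPolynomial.aeval (g ∘ x) := by
    ext i
    have hmk (y) : liftRees (Ideal.Quotient.mk _ y) = SymmetricAlgebra.lift g y := rfl
    simp [reesPresentation, hmk]
  rw [← hcomp, AlgHom.comp_apply, hF, map_zero]

end Presentation

end Rees

section Relation

variable {R : Type u} {N : Type v} [CommRing R] [AddCommGroup N] [Module R N]
  [Module.FinitePresentation R N] {P : PrimeSpectrum R}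

theorem mkLinearMap_mem_maximalIdeal_smul_top (hP : P ∈ Module.freeLocus R N) {y : N}
    (hy : orderIdeal R y ≤ P.asIdeal) :
    LocalizedModule.mkLinearMap P.asIdeal.primeCompl N y ∈
      IsLocalRing.maximalIdeal (Localization.AtPrime P.asIdeal) •
        (⊤ : Submodule (Localization.AtPrime P.asIdeal)
          (LocalizedModule P.asIdeal.primeCompl N)) := by
  let A := Localization.AtPrime P.asIdeal
  have : Module.Free A (LocalizedModule P.asIdeal.primeCompl N) := hP
  let b := Module.finBasis A (LocalizedModule P.asIdeal.primeCompl N)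
  rw [← b.sum_repr (LocalizedModule.mkLinearMap P.asIdeal.primeCompl N y)]
  refine Submodule.sum_mem _ fun j _ ↦ Submodule.smul_mem_smul ?_ trivial
  obtain ⟨f, s, hf⟩ := exists_dual_eq_smul_localized P.asIdeal (b.coord j)
  have hfy : algebraMap R A (f y) ∈ IsLocalRing.maximalIdeal A :=
    (IsLocalization.AtPrime.to_map_mem_maximal_iff A P.asIdeal _).2 (hy ⟨f, rfl⟩)
  rw [hf, Submonoid.smul_def, Algebra.smul_def] at hfy
  refine ((IsLocalRing.maximalIdeal.isMaximal A).isPrime.mem_or_mem hfy).resolve_left fun hs ↦ ?_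
  exact s.2 ((IsLocalization.AtPrime.to_map_mem_maximal_iff A P.asIdeal _).1 hs)

variable {n : ℕ} {x : Fin n → N}

/-- If `N_P` is free and `N^*(∑ aᵢ xᵢ) ⊆ P`, then `∑ aᵢ xᵢ ∈ P N_P = ∑ P R_P xᵢ`, so `a` is
congruent modulo `P` to a relation on the `xᵢ`. -/
theorem exists_relation_of_orderIdeal_le (hx : Submodule.span R (Set.range x) = ⊤)
    (hP : P ∈ Module.freeLocus R N) {a : Fin n → R}
    (ha : orderIdeal R (∑ i, a i • x i) ≤ P.asIdeal) :
    ∃ b : Fin n → Localization.AtPrime P.asIdeal,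
      ∑ i, b i • LocalizedModule.mkLinearMap P.asIdeal.primeCompl N (x i) = 0 ∧
      algebraMap _ P.asIdeal.ResidueField ∘ b = algebraMap R P.asIdeal.ResidueField ∘ a := by
  have hmem := mkLinearMap_mem_maximalIdeal_smul_top hP ha
  rw [← span_range_mkLinearMap_eq_top P.asIdeal hx,
    Submodule.mem_ideal_smul_span_iff_exists_sum] at hmem
  obtain ⟨c, hc, hcy⟩ := hmem
  rw [Finsupp.sum_fintype _ _ (by simp)] at hcy
  refine ⟨fun i ↦ algebraMap R _ (a i) - c i, ?_, funext fun i ↦ ?_⟩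
  · simp only [Function.comp_apply] at hcy
    simp only [sub_smul, Finset.sum_sub_distrib, hcy, algebraMap_smul, map_sum, map_smul, sub_self]
  · have hci : algebraMap _ P.asIdeal.ResidueField (c i) = 0 :=
      (IsLocalRing.residue_eq_zero_iff _).2 (hc i)
    simp only [Function.comp_apply, map_sub, hci, sub_zero, ← IsScalarTower.algebraMap_apply]

theorem eval_mem_of_reesPresentation_perpGen_eq_zero [Module.FinitePresentation R (Perp R x)]
    (hx : Submodule.span R (Set.range x) = ⊤) {F : MvPolynomial (Fin n) R}
    (hF : reesPresentation (perpGen (R := R) x) F = 0) (hP : P ∈ Module.freeLocus R N)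
    {a : Fin n → R} (ha : orderIdeal R (∑ i, a i • x i) ≤ P.asIdeal) :
    MvPolynomial.eval a F ∈ P.asIdeal := by
  obtain ⟨b, hb, hab⟩ := exists_relation_of_orderIdeal_le hx hP ha
  let g : Perp R x →ₗ[R] Localization.AtPrime P.asIdeal := perpLift x b fun f ↦ by
    obtain ⟨f', hf'⟩ := exists_dual_localized_eq P.asIdeal f
    have hzero := congr(f' $hb)
    simp only [map_sum, map_smul, hf', smul_eq_mul, map_zero] at hzero
    simpa only [Algebra.smul_def, mul_comm] using hzero
  have hg : g ∘ perpGen x = b := funext (perpLift_perpGen x b _)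
  have hzero := aeval_eq_zero_of_reesPresentation_eq_zero P.asIdeal.primeCompl hF g
  rw [hg] at hzero
  have hzero' : MvPolynomial.aeval (algebraMap R P.asIdeal.ResidueField ∘ a) F = 0 := by
    rw [← hab, MvPolynomial.aeval_algebraMap_apply, hzero, map_zero]
  rw [← Ideal.algebraMap_residueField_eq_zero, ← hzero']
  exact (MvPolynomial.aeval_algebraMap_apply _ a F).symm

end Relation

section GenericElement

variable {R : Type u} {N : Type v} [CommRing R] [AddCommGroup N] [Module R N]

theorem exists_ideal_le_iff_notMem_freeLocus [Module.FinitePresentation R N] :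
    ∃ J : Ideal R, ∀ P : PrimeSpectrum R, J ≤ P.asIdeal ↔ P ∉ Module.freeLocus R N := by
  obtain ⟨J, hJ⟩ := (PrimeSpectrum.isClosed_iff_zeroLocus_ideal _).1
    (Module.isOpen_freeLocus (R := R) (M := N)).isClosed_compl
  exact ⟨J, fun P ↦ (Set.ext_iff.1 hJ P).symm⟩

section

variable {σ : Type*} [Fintype σ]

/-- The order ideal of the generic element `∑ Xᵢ xᵢ` of `N ⊗ R[X]`: it is generated by the linear
forms `∑ f(xᵢ) Xᵢ` for `f` in `N^*`, and specializes to the order ideals of the `∑ aᵢ xᵢ`. -/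
noncomputable def genericOrderIdeal (x : σ → N) : Ideal (MvPolynomial σ R) :=
  Ideal.span (Set.range fun f : Module.Dual R N ↦ linearForm (f ∘ x))

theorem map_eval_genericOrderIdeal_le (x : σ → N) (a : σ → R) :
    (genericOrderIdeal x).map (MvPolynomial.eval a) ≤ orderIdeal R (∑ i, a i • x i) := by
  rw [genericOrderIdeal, Ideal.map_span, Ideal.span_le]
  rintro _ ⟨_, ⟨f, rfl⟩, rfl⟩
  exact ⟨f, by simp [eval_linearForm, mul_comm]⟩

end

variable [IsNoetherianRing R] [Module.FinitePresentation R N] {n : ℕ} {x : Fin n → N}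

/-- Modulo a prime `P` of the nonfree locus, at least `rf_P(N)` of the linear forms generating
the generic order ideal are independent. -/
theorem LargeFreeSummands.le_height_genericOrderIdeal {r : ℕ} (hN : LargeFreeSummands R N r)
    (hx : Submodule.span R (Set.range x) = ⊤) {J : Ideal R}
    (hJ : ∀ P : PrimeSpectrum R, J ≤ P.asIdeal → P ∉ Module.freeLocus R N) :
    (r : ℕ∞) + 1 ≤ (J.map MvPolynomial.C ⊔ genericOrderIdeal x).height := by
  refine le_height_iff_forall_isPrime.2 fun Q hQ hJQ ↦ ?_
  obtain ⟨hJQ, hQx⟩ := sup_le_iff.1 hJQ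
  let P : PrimeSpectrum R := ⟨Q.comap MvPolynomial.C, inferInstance⟩
  have hrf := hN P (hJ P (Ideal.map_le_iff_le_comap.1 hJQ))
  rw [localDim_eq_height, add_comm (rf R N P : WithBot ℕ∞)] at hrf
  have hforms : P.asIdeal.height +
      Module.finrank P.asIdeal.ResidueField (dualSpan R P.asIdeal.ResidueField x) ≤ Q.height :=
    height_add_finrank_span_le_height (c := fun f : Module.Dual R N ↦ f ∘ x) rfl
      fun f ↦ hQx (Ideal.subset_span ⟨f, rfl⟩)
  rw [← rf_eq_finrank_dualSpan hx P] at hforms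
  exact le_trans (by exact_mod_cast hrf) hforms

end GenericElement

section AnalyticSpread

variable {R : Type u} {N : Type v} [CommRing R] [IsNoetherianRing R] [IsLocalRing R]
  [Infinite (IsLocalRing.ResidueField R)] [AddCommGroup N] [Module R N] [Module.Finite R N]
  {n : ℕ} {x : Fin n → N}

open MvPolynomial IsLocalRing in
theorem LargeFreeSummands.exists_le_height_orderIdeal {r : ℕ} (hN : LargeFreeSummands R N r)
    (hx : Submodule.span R (Set.range x) = ⊤) {F : MvPolynomial (Fin n) R}
    (hF : reesPresentation (perpGen (R := R) x) F = 0) (hF₀ : map (residue R) F ≠ 0) :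
    ∃ y : N, (r : ℕ∞) + 1 ≤ (orderIdeal R y).height := by
  have := Module.finitePresentation_of_finite R N
  have := Module.finitePresentation_of_finite R (Perp R x)
  obtain ⟨J, hJ⟩ := exists_ideal_le_iff_notMem_freeLocus (R := R) (N := N)
  obtain ⟨a, haF, haI⟩ := exists_eval_ne_zero_and_le_height
    (hN.le_height_genericOrderIdeal hx fun P ↦ (hJ P).1) hF₀
  have hunit : IsUnit (eval a F) := by
    rwa [← residue_ne_zero_iff_isUnit, eval₂_comp, ← eval_map]
  refine ⟨∑ i, a i • x i, le_height_iff_forall_isPrime.2 fun P hP haP ↦ ?_⟩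
  by_cases hfree : (⟨P, hP⟩ : PrimeSpectrum R) ∈ Module.freeLocus R N
  · have hmem := eval_mem_of_reesPresentation_perpGen_eq_zero hx hF hfree haP
    exact absurd (P.eq_top_of_isUnit_mem hmem hunit) hP.ne_top
  · refine haI.trans (Ideal.height_mono ?_)
    rw [Ideal.map_sup, Ideal.map_map, eval, eval₂Hom_comp_C, Ideal.map_id]
    exact sup_le ((hJ ⟨P, hP⟩).2 hfree) ((map_eval_genericOrderIdeal_le x a).trans haP)

theorem LargeFreeSummands.analyticSpread_perp_eq {r : ℕ} (hN : LargeFreeSummands R N r)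
    (hx : Submodule.span R (Set.range x) = ⊤)
    (hr : ∀ y : N, (orderIdeal R y).height ≤ r) :
    analyticSpread R (Perp R x) = n := by
  refine ringKrullDim_residueField_tensorProduct
    (reesPresentation_surjective (span_range_perpGen (R := R) x)) fun F hF ↦ ?_
  by_contra hF₀
  obtain ⟨y, hy⟩ := hN.exists_le_height_orderIdeal hx hF hF₀
  exact absurd (hy.trans (hr y)) (by exact_mod_cast r.not_succ_le_self)

end AnalyticSpread

end OrderIdeals

open OrderIdeals in
theorem proposition3p9_general {R : Type u} {N : Type v} [CommRing R] [IsNoetherianRing R]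
    [IsLocalRing R] [Infinite (IsLocalRing.ResidueField R)]
    [AddCommGroup N] [Module R N] [Module.Finite R N] {n : ℕ}
    (x : Fin n → N) (hx : Submodule.span R (Set.range x) = ⊤) (r : ℕ) :
    (LargeFreeSummands R N r → (∀ y : N, (orderIdeal R y).height ≤ (r : ℕ∞)) →
      analyticSpread R (Perp R x) = (n : WithBot ℕ∞)) ∧
    (HasGenericRank R N r → SatisfiesGInfty R (Perp R x) → LargeFreeSummands R N r) ∧
    (HasGenericRank R N r → SatisfiesGInfty R (Perp R x) →
      (∀ y : N, (orderIdeal R y).height ≤ (r : ℕ∞)) →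
      analyticSpread R (Perp R x) = (n : WithBot ℕ∞)) := by
  have large (hN : HasGenericRank R N r) (hG : SatisfiesGInfty R (Perp R x)) :
      LargeFreeSummands R N r := largeFreeSummands_of_satisfiesGInfty hx hN hG
  exact ⟨fun hL hr ↦ hL.analyticSpread_perp_eq hx hr, large,
    fun hN hG hr ↦ (large hN hG).analyticSpread_perp_eq hx hr⟩

theorem proposition3p9 {R : Type u} {N : Type v} [CommRing R] [IsNoetherianRing R]
    [IsLocalRing R] [Infinite (IsLocalRing.ResidueField R)]
    [AddCommGroup N] [Module R N] [Module.Finite R N]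
    (x : Fin (OrderIdeals.minGens R N) → N) (hx : Submodule.span R (Set.range x) = ⊤) (r : ℕ) :
    (OrderIdeals.LargeFreeSummands R N r →
      (∀ y : N, (OrderIdeals.orderIdeal R y).height ≤ (r : ℕ∞)) →
      OrderIdeals.analyticSpread R (OrderIdeals.Perp R x) =
        (OrderIdeals.minGens R N : WithBot ℕ∞)) ∧
    (OrderIdeals.HasGenericRank R N r →
      OrderIdeals.SatisfiesGInfty R (OrderIdeals.Perp R x) →
      OrderIdeals.LargeFreeSummands R N r) ∧
    (OrderIdeals.HasGenericRank R N r →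
      OrderIdeals.SatisfiesGInfty R (OrderIdeals.Perp R x) →
      (∀ y : N, (OrderIdeals.orderIdeal R y).height ≤ (r : ℕ∞)) →
      OrderIdeals.analyticSpread R (OrderIdeals.Perp R x) =
        (OrderIdeals.minGens R N : WithBot ℕ∞)) :=
  proposition3p9_general x hx r
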